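/- Let $T\subset\mathbb{R}^3$ be a (nondegenerate) tetrahedron and let $F\subset\partial T$ be one of its four faces; write $|T|$ for the volume of $T$ and $|F|$ for the area of $F$. For an integer $m\ge 0$ let $\mathbb{P}_m(T)$ be the space of real polynomials of total degree at most $m$ on $T$, and let $\Pi_T^m$ be the $L^2(T)$-orthogonal projection onto $\mathbb{P}_m(T)$; set $\Pi_T^{-1}:=0$. Let $p\ge 0$ and $-1\le n\le p$ be integers. Then for every $\xi\in\mathbb{P}_p(T)$, the polynomial $\theta:=\xi-\Pi_T^n\xi$ satisfies $$\|\theta\|_{L^2(F)}^2\;\le\;\frac{(p-n)(p+n+4)}{3}\,\frac{|F|}{|T|}\,\|\theta\|_{L^2(T)}^2 .$$ -/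

import Mathlib

open MeasureTheory

noncomputable section

/-- A (nondegenerate) tetrahedron in Euclidean 3-space, given by four affinely independent
vertices. As a point set it is `T.closedInterior`, and its four (triangular) faces are the sets
`(T.faceOpposite i).closedInterior`. -/
abbrev Tetrahedron : Type := Affine.Simplex ℝ (EuclideanSpace ℝ (Fin 3)) 3

/-- The polynomials of total degree at most `n`; this is the zero space for `n = -1`. -/
def polySpace : ℤ → Submodule ℝ (MvPolynomial (Fin 3) ℝ)
  | Int.ofNat n => MvPolynomial.restrictTotalDegree (Fin 3) ℝ n
  | Int.negSucc _ => ⊥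

/-- The function on Euclidean 3-space defined by a polynomial. -/
def polyFun (P : MvPolynomial (Fin 3) ℝ) (x : EuclideanSpace ℝ (Fin 3)) : ℝ :=
  MvPolynomial.eval (fun j => x j) P

/-- `η` is the `L²(T)`-orthogonal projection of `ξ` onto the polynomials of degree at most `n`. -/
def IsL2Projection (T : Tetrahedron) (n : ℤ) (ξ η : MvPolynomial (Fin 3) ℝ) : Prop :=
  η ∈ polySpace n ∧
    ∀ v ∈ polySpace n, ∫ x in T.closedInterior, (polyFun ξ x - polyFun η x) * polyFun v x = 0

theorem continuous_polyFun (P : MvPolynomial (Fin 3) ℝ) : Continuous (polyFun P) := by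
  unfold polyFun
  exact P.continuous_eval.comp (by fun_prop)

theorem isCompact_tetrahedron (T : Tetrahedron) : IsCompact T.closedInterior := by
  rw [← T.convexHull_eq_closedInterior]
  exact (Set.finite_range _).isCompact_convexHull ℝ

theorem nonempty_interior_tetrahedron (T : Tetrahedron) :
    (interior T.closedInterior).Nonempty := by
  rw [← T.convexHull_eq_closedInterior, interior_convexHull_nonempty_iff_affineSpan_eq_top]
  exact T.independent.affineSpan_eq_top_iff_card_eq_finrank_add_one.mpr (by simp)

theorem integrableOn_polyFun_mul (T : Tetrahedron) (P Q : MvPolynomial (Fin 3) ℝ) :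
    IntegrableOn (fun x => polyFun P x * polyFun Q x) T.closedInterior :=
  ((continuous_polyFun P).mul (continuous_polyFun Q)).continuousOn.integrableOn_compact
    (isCompact_tetrahedron T)

/-- The `L²(T)` inner product of two polynomials, as a bilinear map. -/
def l2Form (T : Tetrahedron) :
    MvPolynomial (Fin 3) ℝ →ₗ[ℝ] MvPolynomial (Fin 3) ℝ →ₗ[ℝ] ℝ :=
  LinearMap.mk₂ ℝ (fun P Q => ∫ x in T.closedInterior, polyFun P x * polyFun Q x)
    (fun P P' Q => by
      rw [← integral_add (integrableOn_polyFun_mul T P Q) (integrableOn_polyFun_mul T P' Q)]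
      simp [polyFun, add_mul])
    (fun c P Q => by
      rw [smul_eq_mul, ← integral_const_mul]
      simp [polyFun, mul_assoc])
    (fun P Q Q' => by
      rw [← integral_add (integrableOn_polyFun_mul T P Q) (integrableOn_polyFun_mul T P Q')]
      simp [polyFun, mul_add])
    (fun c P Q => by
      rw [smul_eq_mul, ← integral_const_mul]
      simp [polyFun, mul_left_comm])

theorem l2Form_apply (T : Tetrahedron) (P Q : MvPolynomial (Fin 3) ℝ) :
    l2Form T P Q = ∫ x in T.closedInterior, polyFun P x * polyFun Q x := rfl

theorem eq_zero_of_l2Form_self (T : Tetrahedron) (P : MvPolynomial (Fin 3) ℝ)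
    (h : l2Form T P P = 0) : P = 0 := by
  rw [l2Form_apply] at h
  have hint := integrableOn_polyFun_mul T P P
  rw [setIntegral_eq_zero_iff_of_nonneg_ae
    (Filter.Eventually.of_forall fun x => mul_self_nonneg _) hint] at h
  have h1 : (fun x => polyFun P x * polyFun P x)
      =ᵐ[volume.restrict (interior T.closedInterior)] fun _ => 0 :=
    ae_restrict_of_ae_restrict_of_subset interior_subset h
  have h2 := Measure.eqOn_open_of_ae_eq h1 isOpen_interior
    ((continuous_polyFun P).mul (continuous_polyFun P)).continuousOn continuousOn_const
  obtain ⟨x₀, hx₀⟩ := nonempty_interior_tetrahedron T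
  let e := EuclideanSpace.equiv (Fin 3) ℝ
  have hopen : IsOpen (e.symm ⁻¹' interior T.closedInterior) :=
    isOpen_interior.preimage e.symm.continuous
  obtain ⟨ε, hε, hball⟩ := Metric.isOpen_iff.mp hopen (e x₀) (by simpa using hx₀)
  refine MvPolynomial.funext_set (fun i => Metric.ball (e x₀ i) ε) (fun i => ?_) ?_
  · exact infinite_of_mem_nhds _ (Metric.ball_mem_nhds _ hε)
  · intro y hy
    have hy' : y ∈ Metric.ball (e x₀) ε := by
      rw [Metric.mem_ball, dist_pi_lt_iff hε]
      exact fun i => hy i (Set.mem_univ i)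
    have := h2 (hball hy')
    have h3 : polyFun P (e.symm y) = 0 := by simpa using this
    simpa [polyFun, e] using h3

instance finite_polySpace (n : ℤ) : Module.Finite ℝ (polySpace n) := by
  cases n with
  | ofNat n =>
    change Module.Finite ℝ (MvPolynomial.restrictTotalDegree (Fin 3) ℝ n)
    infer_instance
  | negSucc n =>
    change Module.Finite ℝ (⊥ : Submodule ℝ (MvPolynomial (Fin 3) ℝ))
    infer_instance

theorem isL2Projection_iff (T : Tetrahedron) (n : ℤ) (ξ η : MvPolynomial (Fin 3) ℝ) :
    IsL2Projection T n ξ η ↔ η ∈ polySpace n ∧ ∀ v ∈ polySpace n, l2Form T (ξ - η) v = 0 := by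
  simp only [IsL2Projection, l2Form_apply, polyFun, MvPolynomial.eval_sub]

/-- The `L²(T)`-projection exists and is unique. -/
theorem existsUnique_isL2Projection (T : Tetrahedron) (n : ℤ) (ξ : MvPolynomial (Fin 3) ℝ) :
    ∃! η, IsL2Projection T n ξ η := by
  simp only [isL2Projection_iff]
  let B : polySpace n →ₗ[ℝ] Module.Dual ℝ (polySpace n) :=
    (l2Form T).domRestrict₁₂ (polySpace n) (polySpace n)
  have hB : Function.Injective B := by
    rw [← LinearMap.ker_eq_bot, LinearMap.ker_eq_bot']
    intro v hv
    have : l2Form T v v = 0 := LinearMap.congr_fun hv v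
    exact Subtype.ext (eq_zero_of_l2Form_self T v this)
  have hs : Function.Surjective B :=
    (LinearMap.injective_iff_surjective_of_finrank_eq_finrank
      Subspace.dual_finrank_eq.symm).mp hB
  obtain ⟨η, hη⟩ := hs ((l2Form T ξ).domRestrict (polySpace n))
  refine ⟨η, ⟨η.2, fun v hv => ?_⟩, ?_⟩
  · have : l2Form T η v = l2Form T ξ v := LinearMap.congr_fun hη ⟨v, hv⟩
    rw [map_sub, LinearMap.sub_apply, this, sub_self]
  · rintro η' ⟨h1, h2⟩
    have : B ⟨η', h1⟩ = B η := by
      rw [hη]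
      ext v
      have := h2 v v.2
      rw [map_sub, LinearMap.sub_apply, sub_eq_zero] at this
      exact this.symm
    exact congrArg Subtype.val (hB this)

/-- The `L²(T)`-orthogonal projection `Π_T^n` onto polynomials of degree at most `n`
(with `Π_T^{-1} = 0`). -/
def l2Projection (T : Tetrahedron) (n : ℤ) (ξ : MvPolynomial (Fin 3) ℝ) :
    MvPolynomial (Fin 3) ℝ :=
  (existsUnique_isL2Projection T n ξ).choose

theorem l2Projection_spec (T : Tetrahedron) (n : ℤ) (ξ : MvPolynomial (Fin 3) ℝ) :
    IsL2Projection T n ξ (l2Projection T n ξ) :=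
  (existsUnique_isL2Projection T n ξ).choose_spec.1

end

/-!
Let `C` be the cone with apex `v` over a compact subset `F` of a hyperplane in `ℝ^(d+1)`. The
divergence theorem for the field `P(x)² (x - v)` gives
`(d + 1) |C| ∫_F P² = |F| ∫_C ((d + 1) P² + 2 P · E P)`, where `E = (x - v) · ∇` is the Euler
operator. On polynomials of degree at most `m`, `E` is multiplication by `m` modulo lower degree.
So if such a `P` is orthogonal in `L²(C)` to all polynomials of degree less than `m`, then
`‖P‖²_F = (2m + d + 1) / (d + 1) · |F| / |C| · ‖P‖²_C`.

Split `θ` into mutually orthogonal components of this kind, one in each degree `n < m ≤ p`.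
The triangle inequality on `F` and Cauchy–Schwarz bound `‖θ‖²_F` with the sum of the constants, and
`∑ (2m + d + 1) = (p - n)(p + n + d + 2)`.
-/

section OrthogonalFiltration

open scoped InnerProductSpace

theorem add_sq_le_add_mul_add {S a s t u w : ℝ} (hS : 0 ≤ S) (ha : 0 ≤ a) (hs : 0 ≤ s)
    (ht : 0 ≤ t) (hu : u ^ 2 ≤ S * s) (hw : w ^ 2 ≤ a * t) :
    (u + w) ^ 2 ≤ (S + a) * (s + t) := by
  have hmul : u ^ 2 * w ^ 2 ≤ S * s * (a * t) := by gcongr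
  have hcross : 2 * (u * w) ≤ S * t + a * s :=
    le_of_abs_le (abs_le_of_sq_le_sq (by nlinarith [sq_nonneg (S * t - a * s)]) (by positivity))
  linarith [add_sq u w]

theorem sq_norm_map_le_sum_mul_of_orthogonal {V H₁ H₂ : Type*} [AddCommGroup V] [Module ℝ V]
    [NormedAddCommGroup H₁] [InnerProductSpace ℝ H₁] [SeminormedAddCommGroup H₂] [Module ℝ H₂]
    {A : V →ₗ[ℝ] H₁} {B : V →ₗ[ℝ] H₂} {W : ℕ → Submodule ℝ V} (hW : Monotone W)
    [∀ m, FiniteDimensional ℝ (W m)] {a : ℕ → ℝ} (ha : ∀ m, 0 ≤ a m)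
    (hstep : ∀ m, ∀ x ∈ W (m + 1), (∀ y ∈ W m, ⟪A y, A x⟫_ℝ = 0) → ‖B x‖ ^ 2 ≤ a m * ‖A x‖ ^ 2)
    {N M : ℕ} (hNM : N ≤ M) {x : V} (hx : x ∈ W M) (horth : ∀ y ∈ W N, ⟪A y, A x⟫_ℝ = 0) :
    ‖B x‖ ^ 2 ≤ (∑ m ∈ Finset.Ico N M, a m) * ‖A x‖ ^ 2 := by
  induction M, hNM using Nat.le_induction generalizing x with
  | base =>
    have hAx : ‖A x‖ = 0 := by simpa using horth x hx
    simpa [hAx] using hstep N x (hW N.le_succ hx) horth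
  | succ M hNM ih =>
    let U := (W M).map A
    obtain ⟨r, hr, hAr⟩ : ∃ r ∈ W M, A r = U.starProjection (A x) :=
      U.starProjection_apply_mem (A x)
    have hperp : ∀ y ∈ W M, ⟪A y, A (x - r)⟫_ℝ = 0 := fun y hy => by
      rw [map_sub, hAr, real_inner_comm]
      exact U.starProjection_inner_eq_zero (A x) (A y) (Submodule.mem_map_of_mem hy)
    have hpythagoras : ‖A x‖ ^ 2 = ‖A r‖ ^ 2 + ‖A (x - r)‖ ^ 2 := by
      simpa [sq] using norm_add_sq_eq_norm_sq_add_norm_sq_of_inner_eq_zero _ _ (hperp r hr)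
    have hB_r := ih hr fun y hy => by
      have := hperp y (hW hNM hy)
      rwa [map_sub, inner_sub_right, horth y hy, zero_sub, neg_eq_zero] at this
    have hB_sub := hstep M (x - r) (sub_mem hx (hW M.le_succ hr)) hperp
    calc ‖B x‖ ^ 2 = ‖B r + B (x - r)‖ ^ 2 := by rw [← map_add, add_sub_cancel]
      _ ≤ (‖B r‖ + ‖B (x - r)‖) ^ 2 := by gcongr; exact norm_add_le _ _
      _ ≤ (∑ m ∈ Finset.Ico N (M + 1), a m) * ‖A x‖ ^ 2 := by
        rw [Finset.sum_Ico_succ_top hNM, hpythagoras]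
        exact add_sq_le_add_mul_add (Finset.sum_nonneg fun m _ => ha m) (ha M) (sq_nonneg _)
          (sq_nonneg _) hB_r hB_sub

end OrthogonalFiltration

section Polynomials

open MvPolynomial

variable {ι R : Type*} [CommRing R]

/-- The polynomials of total degree less than `m`. The strict inequality makes `degreeLT ι R 0` the
zero space, so that natural numbers index all the spaces `ℙ₋₁, ℙ₀, ℙ₁, …`. -/
noncomputable def degreeLT (ι R : Type*) [CommRing R] (m : ℕ) : Submodule R (MvPolynomial ι R) :=
  restrictSupport R {s | s.degree < m}

theorem degreeLT_mono : Monotone (degreeLT ι R) := fun _ _ h =>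
  restrictSupport_mono R fun _ hs => lt_of_lt_of_le hs h

instance finite_degreeLT [Finite ι] (m : ℕ) : Module.Finite R (degreeLT ι R m) :=
  have : Finite {s : ι →₀ ℕ | s.degree < m} := Finsupp.finite_of_degree_lt m
  Module.Finite.of_basis (basisRestrictSupport R {s : ι →₀ ℕ | s.degree < m})

theorem monomial_mem_degreeLT {m : ℕ} {s : ι →₀ ℕ} (hs : s.degree < m) (a : R) :
    monomial s a ∈ degreeLT ι R m :=
  (monomial_mem_restrictSupport R).2 (Or.inl hs)

/-- The derivation `(x - v) · ∇` of the polynomial ring, generating the dilations about `v`. -/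
noncomputable def eulerOperator (v : ι → R) :
    Derivation R (MvPolynomial ι R) (MvPolynomial ι R) :=
  mkDerivation R fun i => X i - C (v i)

theorem eulerOperator_X (v : ι → R) (i : ι) : eulerOperator v (X i) = X i - C (v i) :=
  mkDerivation_X R _ i

theorem eulerOperator_monomial_sub_nsmul_mem_degreeLT (v : ι → R) (s : ι →₀ ℕ) :
    eulerOperator v (monomial s 1) - s.degree • monomial s 1 ∈ degreeLT ι R s.degree := by
  rw [eulerOperator, mkDerivation_monomial, one_smul, Finsupp.degree_apply, Finset.sum_smul,
    Finsupp.sum, ← Finset.sum_sub_distrib]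
  refine Submodule.sum_mem _ fun i hi => ?_
  have hle : Finsupp.single i 1 ≤ s := by simpa [Nat.one_le_iff_ne_zero] using hi
  have hcancel : s - Finsupp.single i 1 + Finsupp.single i 1 = s := tsub_add_cancel_of_le hle
  have hdegree : (s - Finsupp.single i 1).degree < s.degree := by
    conv_rhs => rw [← hcancel, map_add, Finsupp.degree_single]
    exact Nat.lt_succ_self _
  have hterm : monomial (s - Finsupp.single i 1) ((s i : ℕ) : R) • (X i - C (v i)) -
      s i • monomial s (1 : R) = -monomial (s - Finsupp.single i 1) (s i * v i) := by
    rw [smul_eq_mul, mul_sub, X, C_apply, monomial_mul, monomial_mul, hcancel, add_zero, mul_one,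
      ← Nat.cast_smul_eq_nsmul R, smul_monomial, smul_eq_mul, mul_one, sub_sub_cancel_left]
  rw [hterm]
  exact neg_mem (monomial_mem_degreeLT hdegree _)

theorem eulerOperator_sub_nsmul_mem_degreeLT (v : ι → R) {m : ℕ} {P : MvPolynomial ι R}
    (hP : P ∈ degreeLT ι R (m + 1)) : eulerOperator v P - m • P ∈ degreeLT ι R m := by
  suffices degreeLT ι R (m + 1) ≤
      (degreeLT ι R m).comap ((eulerOperator v).toLinearMap - m • LinearMap.id) from this hP
  rw [degreeLT, restrictSupport_eq_span, Submodule.span_le, Set.image_subset_iff]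
  intro s hs
  change eulerOperator v (monomial s 1) - m • monomial s 1 ∈ degreeLT ι R m
  obtain hlt | rfl := Nat.lt_succ_iff_lt_or_eq.1 hs
  · have hE := degreeLT_mono hlt.le (eulerOperator_monomial_sub_nsmul_mem_degreeLT v s)
    have hmono := monomial_mem_degreeLT hlt (1 : R)
    have := (degreeLT ι R m).add_mem hE (sub_mem (nsmul_mem hmono s.degree) (nsmul_mem hmono m))
    simpa using this
  · exact eulerOperator_monomial_sub_nsmul_mem_degreeLT v s

end Polynomials

section PolynomialFunctions

open MvPolynomial

variable {ι : Type*}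

theorem contDiff_eval_ofLp [Fintype ι] (P : MvPolynomial ι ℝ) :
    ContDiff ℝ 1 fun x : EuclideanSpace ℝ ι => eval x.ofLp P := by
  induction P using MvPolynomial.induction_on with
  | C a => simpa using contDiff_const
  | add P Q hP hQ => simpa using hP.add hQ
  | mul_X P i hP =>
    simp only [map_mul, eval_X]
    exact hP.mul (by fun_prop)

theorem fderiv_eval_ofLp_sub [Finite ι] (P : MvPolynomial ι ℝ) (v x : EuclideanSpace ℝ ι) :
    fderiv ℝ (fun x : EuclideanSpace ℝ ι => eval x.ofLp P) x (x - v) =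
      eval x.ofLp (eulerOperator v.ofLp P) := by
  have := Fintype.ofFinite ι
  induction P using MvPolynomial.induction_on with
  | C a => simp [eulerOperator]
  | add P Q hP hQ =>
    have hdP := (contDiff_eval_ofLp P).differentiable one_ne_zero x
    have hdQ := (contDiff_eval_ofLp Q).differentiable one_ne_zero x
    simp only [map_add, ← hP, ← hQ, fderiv_fun_add hdP hdQ, add_apply]
  | mul_X P i hP =>
    have hdP := (contDiff_eval_ofLp P).differentiable one_ne_zero x
    have hproj : HasFDerivAt (fun x : EuclideanSpace ℝ ι => x.ofLp i)
        (EuclideanSpace.proj i : EuclideanSpace ℝ ι →L[ℝ] ℝ) x :=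
      (EuclideanSpace.proj i : EuclideanSpace ℝ ι →L[ℝ] ℝ).hasFDerivAt
    simp only [map_mul, eval_X, Derivation.leibniz, eulerOperator_X,
      (hdP.hasFDerivAt.fun_mul hproj).fderiv, add_apply, smul_apply, hP]
    simp

end PolynomialFunctions

section ConeIntegral

open Module Set
open scoped Pointwise

variable {V : Type*} [NormedAddCommGroup V] [NormedSpace ℝ V]

theorem setIntegral_prod_eq_integral_setIntegral {α β : Type*} [MeasurableSpace α]
    [MeasurableSpace β] {μ : Measure α} {ν : Measure β} [SFinite μ] [SFinite ν] {S : Set (α × β)}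
    (hS : MeasurableSet S) {f : α × β → ℝ} (hf : IntegrableOn f S (μ.prod ν)) :
    ∫ p in S, f p ∂μ.prod ν = ∫ a, ∫ b in Prod.mk a ⁻¹' S, f (a, b) ∂ν ∂μ := by
  rw [← integral_indicator hS, integral_prod _ ((integrable_indicator_iff hS).2 hf)]
  congr with a
  exact integral_indicator (f := fun b => f (a, b)) (measurable_prodMk_left hS)

theorem isCompact_setOf_mem_smul {K : Set V} (hK : IsCompact K) :
    IsCompact {p : ℝ × V | p.1 ∈ Icc (0 : ℝ) 1 ∧ p.2 ∈ p.1 • K} := by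
  have himage : {p : ℝ × V | p.1 ∈ Icc (0 : ℝ) 1 ∧ p.2 ∈ p.1 • K} =
      (fun p : ℝ × V => (p.1, p.1 • p.2)) '' Icc 0 1 ×ˢ K := by
    ext ⟨s, z⟩
    simp [mem_smul_set, and_assoc]
  rw [himage]
  exact (isCompact_Icc.prod hK).image (by fun_prop)

theorem setIntegral_setOf_mem_smul [FiniteDimensional ℝ V] [MeasurableSpace V] [BorelSpace V]
    (μ : Measure V) [μ.IsAddHaarMeasure] {K : Set V} (hK : IsCompact K)
    {g : ℝ × V → ℝ} (hg : Continuous g) :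
    ∫ p in {p : ℝ × V | p.1 ∈ Icc (0 : ℝ) 1 ∧ p.2 ∈ p.1 • K}, g p ∂(volume : Measure ℝ).prod μ =
      ∫ z in K, (∫ s in (0 : ℝ)..1, s ^ finrank ℝ V * g (s, s • z)) ∂μ := by
  have hcompact := isCompact_setOf_mem_smul hK
  have hint : Integrable (fun p : ℝ × V => p.1 ^ finrank ℝ V * g (p.1, p.1 • p.2))
      ((volume.restrict (Ioc 0 1)).prod (μ.restrict K)) := by
    rw [Measure.prod_restrict]
    have hcont : Continuous fun p : ℝ × V => p.1 ^ finrank ℝ V * g (p.1, p.1 • p.2) := by fun_prop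
    exact (hcont.continuousOn.integrableOn_compact (isCompact_Icc.prod hK)).mono_set
      (prod_mono_left Ioc_subset_Icc_self)
  calc
    _ = ∫ s, ∫ z in {z | s ∈ Icc (0 : ℝ) 1 ∧ z ∈ s • K}, g (s, z) ∂μ :=
        setIntegral_prod_eq_integral_setIntegral hcompact.measurableSet
          (hg.continuousOn.integrableOn_compact hcompact)
    _ = ∫ s in Icc (0 : ℝ) 1, ∫ z in s • K, g (s, z) ∂μ := by
        rw [← integral_indicator measurableSet_Icc]
        congr with s
        by_cases hs : s ∈ Icc (0 : ℝ) 1 <;> simp [hs]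
    _ = ∫ s in Ioc (0 : ℝ) 1, ∫ z in K, s ^ finrank ℝ V * g (s, s • z) ∂μ := by
        rw [integral_Icc_eq_integral_Ioc]
        refine setIntegral_congr_fun measurableSet_Ioc fun s hs => ?_
        rw [integral_const_mul, Measure.setIntegral_comp_smul_of_pos μ (fun z => g (s, z)) K hs.1,
          smul_eq_mul, mul_inv_cancel_left₀ (pow_pos hs.1 _).ne']
    _ = _ := by
        rw [integral_integral_swap hint]
        simp only [intervalIntegral.integral_of_le zero_le_one]

theorem exists_setIntegral_image_const_add_eq_mul {G E : Type*} [NormedAddCommGroup G]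
    [NormedSpace ℝ G] [MeasurableSpace G] [BorelSpace G] [NormedAddCommGroup E] [NormedSpace ℝ E]
    [FiniteDimensional ℝ E] [MeasurableSpace E] [BorelSpace E] (μ : Measure G) [μ.IsAddHaarMeasure]
    (ν : Measure E) [ν.IsAddHaarMeasure] (Ψ : G ≃L[ℝ] E) (v : E) :
    ∃ c : ℝ, ∀ (S : Set G) (f : E → ℝ),
      ∫ x in (fun p => v + Ψ p) '' S, f x ∂ν = c * ∫ p in S, f (v + Ψ p) ∂μ := by
  have := Ψ.isAddHaarMeasure_map μ
  refine ⟨ν.addHaarScalarFactor (μ.map Ψ), fun S f => ?_⟩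
  let e : G ≃ₜ E := Ψ.toHomeomorph.trans (Homeomorph.addLeft v)
  have hmap : μ.map e = μ.map Ψ := by
    rw [← map_add_left_eq_self (μ.map Ψ) v, Measure.map_map (by fun_prop) (by fun_prop)]
    rfl
  have hν : ν = ν.addHaarScalarFactor (μ.map Ψ) • μ.map e :=
    (Measure.isAddLeftInvariant_eq_smul ν (μ.map Ψ)).trans (by rw [hmap])
  conv_lhs => rw [hν]
  rw [Measure.restrict_smul, integral_smul_nnreal_measure, NNReal.smul_def, smul_eq_mul,
    e.measurableEmbedding.setIntegral_map]
  change _ * ∫ p in e ⁻¹' (e '' S), f (e p) ∂μ = _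
  rw [e.preimage_image]
  rfl

end ConeIntegral

section Cone

open AffineMap Module Set
open scoped Pointwise

variable {E : Type*} [NormedAddCommGroup E] [InnerProductSpace ℝ E]

theorem isometry_direction_add_const (A : AffineSubspace ℝ E) (q : E) :
    Isometry fun z : A.direction => (z : E) + q :=
  (isometry_add_right q).comp isometry_subtype_coe

theorem range_direction_add_const {A : AffineSubspace ℝ E} {q : E} (hq : q ∈ A) :
    range (fun z : A.direction => (z : E) + q) = A := by
  ext x
  simp only [mem_range, SetLike.mem_coe, ← AffineSubspace.vsub_right_mem_direction_iff_mem hq x,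
    vsub_eq_sub, Subtype.exists, exists_prop, ← eq_sub_iff_add_eq, exists_eq_right]

theorem convexJoin_singleton_eq_image {A : AffineSubspace ℝ E} {q : E} (hq : q ∈ A) (v : E)
    {F : Set E} (hF : F ⊆ A) :
    convexJoin ℝ {v} F = (fun p : ℝ × A.direction => v + (p.1 • (q - v) + p.2)) ''
      {p | p.1 ∈ Icc (0 : ℝ) 1 ∧ p.2 ∈ p.1 • (fun z : A.direction => (z : E) + q) ⁻¹' F} := by
  ext x
  simp only [convexJoin_singleton_left, mem_iUnion, segment_eq_image', mem_image, exists_prop]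
  constructor
  · rintro ⟨y, hy, s, hs, rfl⟩
    obtain ⟨z, rfl⟩ := (range_direction_add_const hq).superset (hF hy)
    refine ⟨(s, s • z), ⟨hs, smul_mem_smul_set hy⟩, ?_⟩
    simp only [SetLike.val_smul, add_right_inj]
    module
  · rintro ⟨⟨s, z'⟩, ⟨hs, z, hz, rfl : s • z = z'⟩, rfl⟩
    refine ⟨z + q, hz, s, hs, ?_⟩
    simp only [SetLike.val_smul, add_right_inj]
    module

variable [FiniteDimensional ℝ E]

theorem exists_continuousLinearEquiv_prod_direction {A : AffineSubspace ℝ E}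
    (hA : finrank ℝ E = finrank ℝ A.direction + 1) {q v : E} (hq : q ∈ A) (hv : v ∉ A) :
    ∃ Ψ : (ℝ × A.direction) ≃L[ℝ] E, ∀ s z, Ψ (s, z) = s • (q - v) + z := by
  let Φ : (ℝ × A.direction) →ₗ[ℝ] E :=
    (LinearMap.toSpanSingleton ℝ E (q - v)).coprod A.direction.subtype
  have hΦ (s : ℝ) (z : A.direction) : Φ (s, z) = s • (q - v) + z := by simp [Φ]
  have hdir : v - q ∉ A.direction := by
    rwa [← vsub_eq_sub, AffineSubspace.vsub_right_mem_direction_iff_mem hq]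
  have hinj : Function.Injective Φ := by
    rw [← LinearMap.ker_eq_bot, LinearMap.ker_eq_bot']
    rintro ⟨s, z⟩ h
    rw [hΦ] at h
    have hs : s = 0 := by
      by_contra hs
      refine hdir ((A.direction.smul_mem_iff hs).1 ?_)
      convert z.2 using 1
      rw [← sub_eq_zero, ← neg_eq_zero, ← h]
      module
    subst hs
    simpa using h
  exact ⟨(Φ.linearEquivOfInjective hinj (by simp [hA, add_comm])).toContinuousLinearEquiv, hΦ⟩

variable [MeasurableSpace E] [BorelSpace E]

theorem euclideanHausdorffMeasure_restrict_eq_map {A : AffineSubspace ℝ E} {q : E} (hq : q ∈ A)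
    {F : Set E} (hFm : MeasurableSet F) (hF : F ⊆ A) :
    (μHE[finrank ℝ A.direction] : Measure E).restrict F =
      (volume.restrict ((fun z : A.direction => (z : E) + q) ⁻¹' F)).map
        fun z : A.direction => (z : E) + q := by
  have hiso := isometry_direction_add_const A q
  rw [← Measure.restrict_map hiso.continuous.measurable hFm,
    ← InnerProductSpace.euclideanHausdorffMeasure_eq_volume, hiso.map_euclideanHausdorffMeasure,
    range_direction_add_const hq, Measure.restrict_restrict hFm, inter_eq_left.2 hF]

theorem euclideanHausdorffMeasure_lt_top_of_isCompact {A : AffineSubspace ℝ E}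
    {F : Set E} (hFc : IsCompact F) (hF : F ⊆ A) :
    (μHE[finrank ℝ A.direction] : Measure E) F < ⊤ := by
  obtain rfl | ⟨q, hq⟩ := F.eq_empty_or_nonempty
  · simp
  have hiso := isometry_direction_add_const A q
  rw [← Measure.restrict_apply_univ,
    euclideanHausdorffMeasure_restrict_eq_map (hF hq) hFc.measurableSet hF,
    Measure.map_apply hiso.continuous.measurable .univ, preimage_univ, Measure.restrict_apply_univ]
  exact (hiso.isClosedEmbedding.isCompact_preimage hFc).measure_lt_top

theorem exists_setIntegral_convexJoin_singleton (ν : Measure E) [ν.IsAddHaarMeasure]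
    {A : AffineSubspace ℝ E} (hA : finrank ℝ E = finrank ℝ A.direction + 1) {v : E} (hv : v ∉ A)
    {F : Set E} (hFc : IsCompact F) (hF : F ⊆ A) :
    ∃ c : ℝ, ∀ f : E → ℝ, Continuous f → ∫ x in convexJoin ℝ {v} F, f x ∂ν =
      c * ∫ y in F, (∫ s in (0 : ℝ)..1, s ^ finrank ℝ A.direction * f (lineMap v y s))
        ∂μHE[finrank ℝ A.direction] := by
  obtain rfl | ⟨q, hq⟩ := F.eq_empty_or_nonempty
  · exact ⟨1, by simp⟩
  obtain ⟨Ψ, hΨ⟩ := exists_continuousLinearEquiv_prod_direction hA (hF hq) hv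
  obtain ⟨c, hcov⟩ := exists_setIntegral_image_const_add_eq_mul
    ((volume : Measure ℝ).prod (volume : Measure A.direction)) ν Ψ v
  have hemb := (isometry_direction_add_const A q).isClosedEmbedding
  refine ⟨c, fun f hf => ?_⟩
  have hray (s : ℝ) (z : A.direction) : v + Ψ (s, s • z) = lineMap v (z + q) s := by
    rw [hΨ, lineMap_apply_module', Submodule.coe_smul]
    module
  rw [convexJoin_singleton_eq_image (hF hq) v hF]
  simp only [← hΨ]
  rw [hcov, setIntegral_setOf_mem_smul volume (hemb.isCompact_preimage hFc) (by fun_prop),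
    euclideanHausdorffMeasure_restrict_eq_map (hF hq) hFc.measurableSet hF,
    hemb.measurableEmbedding.integral_map]
  simp only [hray]

end Cone

section Divergence

open AffineMap Module Set

variable {E : Type*} [NormedAddCommGroup E]

theorem integral_pow_mul_divergence_lineMap [NormedSpace ℝ E] (d : ℕ) {f : E → ℝ}
    (hf : ContDiff ℝ 1 f) (v y : E) :
    ∫ s in (0 : ℝ)..1, s ^ d * ((d + 1) * f (lineMap v y s) +
      fderiv ℝ f (lineMap v y s) (lineMap v y s - v)) = f y := by
  have : Continuous (fderiv ℝ f) := hf.continuous_fderiv one_ne_zero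
  have hderiv (s : ℝ) : HasDerivAt (fun s : ℝ => s ^ (d + 1) * f (lineMap v y s))
      (s ^ d * ((d + 1) * f (lineMap v y s) +
        fderiv ℝ f (lineMap v y s) (lineMap v y s - v))) s := by
    have hfs := (hf.differentiable one_ne_zero _).hasFDerivAt.comp_hasDerivAt s
      (hasDerivAt_lineMap (a := v) (b := y) (x := s))
    refine ((hasDerivAt_pow (d + 1) s).mul hfs).congr_deriv ?_
    have hsub : lineMap v y s - v = s • (y - v) := by simp [lineMap_apply]
    simp only [hsub, map_smul, Nat.cast_add, Nat.cast_one, add_tsub_cancel_right,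
      Function.comp_apply, smul_eq_mul]
    ring
  rw [intervalIntegral.integral_eq_sub_of_hasDerivAt (fun s _ => hderiv s)
    (Continuous.intervalIntegrable (by fun_prop) _ _)]
  simp

theorem isCompact_convexJoin_singleton [NormedSpace ℝ E] (v : E) {F : Set E} (hF : IsCompact F) :
    IsCompact (convexJoin ℝ {v} F) := by
  simp only [convexJoin_singleton_left, segment_eq_image_lineMap,
    iUnion_image_right (fun (s : ℝ) (y : E) => lineMap v y s), ← image_prod]
  exact (isCompact_Icc.prod hF).image (by fun_prop)

variable [InnerProductSpace ℝ E] [FiniteDimensional ℝ E] [MeasurableSpace E] [BorelSpace E]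

/-- The divergence theorem for the field `f(x) (x - v)`, which is tangent to the lateral boundary of
the cone `C`; on the base its normal component is `f` times the height `(d + 1) |C| / |F|`. -/
theorem setIntegral_divergence_convexJoin_singleton (ν : Measure E) [ν.IsAddHaarMeasure] {d : ℕ}
    (hE : finrank ℝ E = d + 1) {A : AffineSubspace ℝ E} (hA : finrank ℝ A.direction = d) {v : E}
    (hv : v ∉ A) {F : Set E} (hFc : IsCompact F) (hF : F ⊆ A) {f : E → ℝ} (hf : ContDiff ℝ 1 f) :
    (μHE[d] : Measure E).real F *
        ∫ x in convexJoin ℝ {v} F, ((d + 1) * f x + fderiv ℝ f x (x - v)) ∂ν =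
      (d + 1) * ν.real (convexJoin ℝ {v} F) * ∫ y in F, f y ∂μHE[d] := by
  subst hA
  obtain ⟨c, hcone⟩ := exists_setIntegral_convexJoin_singleton ν hE hv hFc hF
  have hdiv {g : E → ℝ} (hg : ContDiff ℝ 1 g) :
      ∫ x in convexJoin ℝ {v} F, ((finrank ℝ A.direction + 1) * g x + fderiv ℝ g x (x - v)) ∂ν =
        c * ∫ y in F, g y ∂μHE[finrank ℝ A.direction] := by
    have : Continuous (fderiv ℝ g) := hg.continuous_fderiv one_ne_zero
    have := hg.continuous
    rw [hcone _ (by fun_prop)]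
    simp only [integral_pow_mul_divergence_lineMap _ hg]
  have hvol : ν.real (convexJoin ℝ {v} F) * (finrank ℝ A.direction + 1) =
      c * (μHE[finrank ℝ A.direction] : Measure E).real F := by
    simpa using hdiv (contDiff_const (c := (1 : ℝ)))
  rw [hdiv hf]
  linear_combination (-∫ y in F, f y ∂μHE[finrank ℝ A.direction]) * hvol

end Divergence

section PolynomialsInL2

open MvPolynomial
open scoped InnerProductSpace

variable {ι : Type*} {μ : Measure (EuclideanSpace ℝ ι)}

theorem memLp_two_eval_ofLp_restrict [Finite ι] {K : Set (EuclideanSpace ℝ ι)} (hK : IsCompact K)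
    (hμ : μ K ≠ ⊤) (P : MvPolynomial ι ℝ) :
    MemLp (fun x => eval x.ofLp P) 2 (μ.restrict K) := by
  have := Fintype.ofFinite ι
  have hcont := (contDiff_eval_ofLp P).continuous
  rw [memLp_two_iff_integrable_sq hcont.aestronglyMeasurable]
  exact (hcont.pow 2).continuousOn.integrableOn_of_subset_isCompact hK hK.measurableSet
    subset_rfl hμ

/-- The class in `L²(μ)` of a polynomial function, for measures `μ` such that all polynomial
functions are square integrable. -/
noncomputable def polyToL2 (hμ : ∀ P : MvPolynomial ι ℝ, MemLp (fun x => eval x.ofLp P) 2 μ) :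
    MvPolynomial ι ℝ →ₗ[ℝ] Lp ℝ 2 μ where
  toFun P := (hμ P).toLp
  map_add' P Q := by
    rw [← MemLp.toLp_add]
    exact MemLp.toLp_congr _ _ (.of_forall fun x => map_add _ P Q)
  map_smul' c P := by
    rw [RingHom.id_apply, ← MemLp.toLp_const_smul]
    exact MemLp.toLp_congr _ _ (.of_forall fun x => smul_eval x.ofLp P c)

variable (hμ : ∀ P : MvPolynomial ι ℝ, MemLp (fun x => eval x.ofLp P) 2 μ)

theorem inner_polyToL2 (P Q : MvPolynomial ι ℝ) :
    ⟪polyToL2 hμ P, polyToL2 hμ Q⟫_ℝ = ∫ x, eval x.ofLp Q * eval x.ofLp P ∂μ := by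
  rw [L2.inner_def]
  refine integral_congr_ae ?_
  filter_upwards [(hμ P).coeFn_toLp, (hμ Q).coeFn_toLp] with x hP hQ
  simp [polyToL2, hP, hQ]

theorem sq_norm_polyToL2 (P : MvPolynomial ι ℝ) :
    ‖polyToL2 hμ P‖ ^ 2 = ∫ x, eval x.ofLp P ^ 2 ∂μ := by
  simp only [← real_inner_self_eq_norm_sq, inner_polyToL2, ← sq]

theorem sq_eLpNorm_eval_ofLp (P : MvPolynomial ι ℝ) :
    eLpNorm (fun x => eval x.ofLp P) 2 μ ^ 2 = ENNReal.ofReal (‖polyToL2 hμ P‖ ^ 2) := by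
  rw [ENNReal.ofReal_pow (norm_nonneg _), ofReal_norm]
  exact congrArg (· ^ 2) (Lp.enorm_toLp (hμ P)).symm

theorem integral_eval_eulerOperator_sq_of_orthogonal
    (hint : ∀ Q : MvPolynomial ι ℝ, Integrable (fun x => eval x.ofLp Q) μ) (v : ι → ℝ) {m : ℕ}
    {P : MvPolynomial ι ℝ} (hP : P ∈ degreeLT ι ℝ (m + 1))
    (horth : ∀ Q ∈ degreeLT ι ℝ m, ∫ x, eval x.ofLp P * eval x.ofLp Q ∂μ = 0) :
    ∫ x, eval x.ofLp (eulerOperator v (P ^ 2)) ∂μ = 2 * m * ∫ x, eval x.ofLp P ^ 2 ∂μ := by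
  set R := eulerOperator v P - m • P with hR
  have hsplit : eulerOperator v (P ^ 2) = (2 * m : ℝ) • P ^ 2 + (2 : ℝ) • (P * R) := by
    rw [hR, Derivation.leibniz_pow]
    simp only [smul_eq_C_mul, map_mul, map_ofNat, map_natCast, nsmul_eq_mul, smul_eq_mul]
    push_cast
    ring
  calc
    _ = ∫ x, (2 * m * eval x.ofLp (P ^ 2) + 2 * eval x.ofLp (P * R)) ∂μ := by
      simp only [hsplit, map_add, smul_eval]
    _ = 2 * m * ∫ x, eval x.ofLp P ^ 2 ∂μ := by
      rw [integral_add ((hint _).const_mul _) ((hint _).const_mul _)]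
      simp only [map_pow, map_mul, integral_const_mul,
        horth R (eulerOperator_sub_nsmul_mem_degreeLT v hP), mul_zero, add_zero]

end PolynomialsInL2

section TraceInequality

open MvPolynomial Module
open scoped InnerProductSpace

variable {d : ℕ} {A : AffineSubspace ℝ (EuclideanSpace ℝ (Fin (d + 1)))}
  {F : Set (EuclideanSpace ℝ (Fin (d + 1)))} {v : EuclideanSpace ℝ (Fin (d + 1))}

theorem notMem_of_volume_convexJoin_singleton_ne_zero (hA : finrank ℝ A.direction = d) (hFA : F ⊆ A)
    (hvol : volume (convexJoin ℝ {v} F) ≠ 0) : v ∉ A := by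
  intro hv
  have hne : A ≠ ⊤ := by
    rintro rfl
    rw [AffineSubspace.direction_top, finrank_top, finrank_euclideanSpace_fin] at hA
    exact d.succ_ne_self hA
  have hsub : convexJoin ℝ {v} F ⊆ A :=
    convexJoin_subset (Set.singleton_subset_iff.2 hv) hFA A.convex
  exact hvol (measure_mono_null hsub (Measure.addHaar_affineSubspace volume A hne))

theorem mul_setIntegral_sq_eq_of_orthogonal (hA : finrank ℝ A.direction = d) (hF : IsCompact F)
    (hFA : F ⊆ A) (hv : v ∉ A) {m : ℕ} {P : MvPolynomial (Fin (d + 1)) ℝ}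
    (hP : P ∈ degreeLT (Fin (d + 1)) ℝ (m + 1))
    (horth : ∀ Q ∈ degreeLT (Fin (d + 1)) ℝ m,
      ∫ x in convexJoin ℝ {v} F, eval x.ofLp P * eval x.ofLp Q = 0) :
    (d + 1) * volume.real (convexJoin ℝ {v} F) * ∫ x in F, eval x.ofLp P ^ 2 ∂μHE[d] =
      (μHE[d] : Measure (EuclideanSpace ℝ (Fin (d + 1)))).real F *
        ((2 * m + d + 1) * ∫ x in convexJoin ℝ {v} F, eval x.ofLp P ^ 2) := by
  have hint (Q : MvPolynomial (Fin (d + 1)) ℝ) :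
      IntegrableOn (fun x => eval x.ofLp Q) (convexJoin ℝ {v} F) :=
    (contDiff_eval_ofLp Q).continuous.continuousOn.integrableOn_compact
      (isCompact_convexJoin_singleton v hF)
  have hdiv := setIntegral_divergence_convexJoin_singleton volume (by simp) hA hv hF hFA
    (contDiff_eval_ofLp (P ^ 2))
  simp only [fderiv_eval_ofLp_sub] at hdiv
  rw [integral_add ((hint _).const_mul _) (hint _), integral_const_mul,
    integral_eval_eulerOperator_sq_of_orthogonal hint v.ofLp hP horth] at hdiv
  simp only [map_pow] at hdiv
  linear_combination -hdiv

theorem sum_Ico_two_mul_add {N M : ℕ} (h : N ≤ M) (t : ℝ) :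
    ∑ m ∈ Finset.Ico N M, (2 * m + t + 1) = ((M : ℝ) - N) * (M + N + t) := by
  induction M, h using Nat.le_induction with
  | base => simp
  | succ M h ih =>
    rw [Finset.sum_Ico_succ_top h, ih]
    push_cast
    ring

/-- In the notation of `mainTheorem4`, `M = p + 1` and `N = n + 1`. -/
theorem mainTheorem4_general (hA : finrank ℝ A.direction = d) (hF : IsCompact F) (hFA : F ⊆ A)
    (hvol : volume (convexJoin ℝ {v} F) ≠ 0) {N M : ℕ} (hNM : N ≤ M)
    {θ : MvPolynomial (Fin (d + 1)) ℝ} (hθ : θ ∈ degreeLT (Fin (d + 1)) ℝ M)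
    (horth : ∀ Q ∈ degreeLT (Fin (d + 1)) ℝ N,
      ∫ x in convexJoin ℝ {v} F, eval x.ofLp θ * eval x.ofLp Q = 0) :
    eLpNorm (fun x => eval x.ofLp θ) 2 ((μHE[d]).restrict F) ^ 2 ≤
      ENNReal.ofReal (((M : ℝ) - N) * (M + N + d) / (d + 1)) *
        (μHE[d] F / volume (convexJoin ℝ {v} F)) *
        eLpNorm (fun x => eval x.ofLp θ) 2 (volume.restrict (convexJoin ℝ {v} F)) ^ 2 := by
  have hv := notMem_of_volume_convexJoin_singleton_ne_zero hA hFA hvol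
  have hC := isCompact_convexJoin_singleton v hF
  have hμC : volume (convexJoin ℝ {v} F) ≠ ⊤ := hC.measure_ne_top
  have hμF : μHE[d] F ≠ ⊤ := by
    simpa [hA] using (euclideanHausdorffMeasure_lt_top_of_isCompact hF hFA).ne
  have hCL2 := memLp_two_eval_ofLp_restrict hC hμC
  have hFL2 := memLp_two_eval_ofLp_restrict hF hμF
  have hCpos : 0 < volume.real (convexJoin ℝ {v} F) := ENNReal.toReal_pos hvol hμC
  have hdegree (m : ℕ) (P) (hP : P ∈ degreeLT (Fin (d + 1)) ℝ (m + 1))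
      (hPorth : ∀ Q ∈ degreeLT (Fin (d + 1)) ℝ m, ⟪polyToL2 hCL2 Q, polyToL2 hCL2 P⟫_ℝ = 0) :
      ‖polyToL2 hFL2 P‖ ^ 2 ≤ (2 * m + d + 1) / (d + 1) *
        (μHE[d].real F / volume.real (convexJoin ℝ {v} F)) * ‖polyToL2 hCL2 P‖ ^ 2 := by
    simp only [inner_polyToL2, sq_norm_polyToL2] at hPorth ⊢
    have := mul_setIntegral_sq_eq_of_orthogonal hA hF hFA hv hP hPorth
    apply le_of_eq
    field_simp
    linear_combination this
  have htrace := sq_norm_map_le_sum_mul_of_orthogonal degreeLT_mono (fun m => by positivity)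
    hdegree hNM hθ (by simpa only [inner_polyToL2] using horth)
  rw [← Finset.sum_mul, ← Finset.sum_div, sum_Ico_two_mul_add hNM] at htrace
  have hNM' : 0 ≤ (M : ℝ) - N := sub_nonneg.2 (Nat.cast_le.2 hNM)
  rw [sq_eLpNorm_eval_ofLp hFL2, sq_eLpNorm_eval_ofLp hCL2, ← ofReal_measureReal hμF,
    ← ofReal_measureReal hμC, ← ENNReal.ofReal_div_of_pos hCpos,
    ← ENNReal.ofReal_mul (by positivity), ← ENNReal.ofReal_mul (by positivity)]
  exact ENNReal.ofReal_le_ofReal htrace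

end TraceInequality

section Tetrahedron

open MvPolynomial Set

theorem closedInterior_eq_convexJoin_closedInterior_faceOpposite {E : Type*} [AddCommGroup E]
    [Module ℝ E] {n : ℕ} [NeZero n] (T : Affine.Simplex ℝ E n) (i : Fin (n + 1)) :
    T.closedInterior = convexJoin ℝ {T.points i} (T.faceOpposite i).closedInterior := by
  have hrange : range T.points = insert (T.points i) (range (T.faceOpposite i).points) := by
    rw [Affine.Simplex.range_faceOpposite_points, ← image_insert_eq, ← image_univ]
    congr 1
    ext j
    simp [em]
  rw [← T.convexHull_eq_closedInterior, ← (T.faceOpposite i).convexHull_eq_closedInterior, hrange,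
    convexHull_insert (range_nonempty _)]

theorem polySpace_sub_one (N : ℕ) : polySpace (N - 1) = degreeLT (Fin 3) ℝ N := by
  cases N with
  | zero =>
    change ⊥ = _
    simp [degreeLT, restrictSupport_eq_span]
  | succ N =>
    simp [polySpace, degreeLT, restrictTotalDegree, Finsupp.degree_eq_sum, Finsupp.sum_fintype]

theorem finrank_direction_affineSpan_faceOpposite {E : Type*} [AddCommGroup E] [Module ℝ E]
    {n : ℕ} [NeZero n] (T : Affine.Simplex ℝ E n) (i : Fin (n + 1)) :
    Module.finrank ℝ (affineSpan ℝ (range (T.faceOpposite i).points)).direction = n - 1 := by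
  rw [direction_affineSpan]
  exact (T.faceOpposite i).independent.finrank_vectorSpan (Fintype.card_fin _)

theorem volume_tetrahedron_ne_zero (T : Tetrahedron) : volume T.closedInterior ≠ 0 :=
  (Measure.measure_pos_of_nonempty_interior _ (nonempty_interior_tetrahedron T)).ne'

theorem sub_l2Projection_mem_degreeLT (T : Tetrahedron) {N M : ℕ} (hNM : N ≤ M)
    {ξ : MvPolynomial (Fin 3) ℝ} (hξ : ξ ∈ degreeLT (Fin 3) ℝ M) :
    ξ - l2Projection T (N - 1) ξ ∈ degreeLT (Fin 3) ℝ M := by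
  have hη := (l2Projection_spec T (N - 1) ξ).1
  rw [polySpace_sub_one] at hη
  exact sub_mem hξ (degreeLT_mono hNM hη)

theorem setIntegral_eval_sub_l2Projection_mul_eq_zero (T : Tetrahedron) {N : ℕ}
    (ξ : MvPolynomial (Fin 3) ℝ) {Q : MvPolynomial (Fin 3) ℝ} (hQ : Q ∈ degreeLT (Fin 3) ℝ N) :
    ∫ x in T.closedInterior,
      eval x.ofLp (ξ - l2Projection T (N - 1) ξ) * eval x.ofLp Q = 0 := by
  rw [← polySpace_sub_one] at hQ
  simpa only [map_sub, polyFun] using (l2Projection_spec T (N - 1) ξ).2 Q hQ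

theorem mainTheorem4 (T : Tetrahedron) (i : Fin 4) (p : ℕ) (n : ℤ) (hn : -1 ≤ n) (hnp : n ≤ p)
    (ξ θ : MvPolynomial (Fin 3) ℝ) (hξ : ξ ∈ polySpace p) (hθ : θ = ξ - l2Projection T n ξ) :
    eLpNorm (polyFun θ) 2 ((μHE[2]).restrict (T.faceOpposite i).closedInterior) ^ 2 ≤
      ENNReal.ofReal (((p : ℝ) - n) * (p + n + 4) / 3) *
        (μHE[2] (T.faceOpposite i).closedInterior / volume T.closedInterior) *
        eLpNorm (polyFun θ) 2 (volume.restrict T.closedInterior) ^ 2 := by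
  obtain ⟨N, rfl⟩ : ∃ N : ℕ, n = N - 1 := ⟨(n + 1).toNat, by omega⟩
  have hNp : N ≤ p + 1 := by omega
  have hp : polySpace p = degreeLT (Fin 3) ℝ (p + 1) := by simpa using polySpace_sub_one (p + 1)
  have hθ_mem : θ ∈ degreeLT (Fin 3) ℝ (p + 1) :=
    hθ ▸ sub_l2Projection_mem_degreeLT T hNp (hp ▸ hξ)
  have horth : ∀ Q ∈ degreeLT (Fin 3) ℝ N,
      ∫ x in T.closedInterior, eval x.ofLp θ * eval x.ofLp Q = 0 :=
    hθ ▸ fun _ => setIntegral_eval_sub_l2Projection_mul_eq_zero T ξ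
  have hvol := volume_tetrahedron_ne_zero T
  have hconst : ((p : ℝ) - ((N - 1 : ℤ) : ℝ)) * (p + ((N - 1 : ℤ) : ℝ) + 4) / 3 =
      (((p + 1 : ℕ) : ℝ) - N) * ((p + 1 : ℕ) + N + (2 : ℕ)) / ((2 : ℕ) + 1) := by
    push_cast
    ring
  rw [closedInterior_eq_convexJoin_closedInterior_faceOpposite T i] at horth hvol ⊢
  rw [hconst]
  exact mainTheorem4_general (finrank_direction_affineSpan_faceOpposite T i)
    (T.faceOpposite i).isCompact_closedInterior
    (T.faceOpposite i).closedInterior_subset_affineSpan hvol hNp hθ_mem horth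

end Tetrahedron
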